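/- Let $N\ge 2$. A lattice $L\subset\mathbb R^{N-1}$ (of full rank) is a covering lattice for a set $S\subset\mathbb R^{N-1}$ if the translates $S+l$, $l\in L$, cover $\mathbb R^{N-1}$. Put $\mu(S,L)=\inf\{\sigma>0: L\text{ is a covering lattice for }\sigma S\}$ and $\mu_0(S)=\inf\{\mu(S,L):\det L=1\}$ (the absolute inhomogeneous minimum of $S$), and let $S_{N-1}=\{x\in\mathbb R^{N-1}: x_i\ge 0\text{ for all }i,\ \sum_i x_i\le 1\}$. For positive integers $a_1<\dots<a_N$ with $\gcd(a_1,\dots,a_N)=1$ let $g_N(a)$ be the largest integer that is not a non-negative integer combination of $a_1,\dots,a_N$ (so $g_N(a)=-1$ if $a_1=1$), and let $f_N(a)=g_N(a)+\sum_{i=1}^N a_i$. (i) If $N\ge 3$, then for all positive integers $a_1<\dots<a_N$ with $\gcd(a_1,\dots,a_N)=1$, the number $f_N(a)$ is the largest integer that is not a combination of $a_1,\dots,a_N$ with positive integer coefficients, and $$\mu_0(S_{N-1})\le\frac{f_N(a)}{(a_1\cdots a_N)^{1/(N-1)}}.$$ (ii) For every $N\ge 2$, every $\epsilon>0$ and every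 $\alpha=(\alpha_1,\dots,\alpha_{N-1})\in\mathbb R^{N-1}$ with $0\le\alpha_1\le\alpha_2\le\dots\le\alpha_{N-1}\le 1$ there are integers $0<a_1<a_2<\dots<a_N$ with $\gcd(a_1,\dots,a_N)=1$ such that $$\left|\alpha_i-\frac{a_i}{a_N}\right|<\epsilon\quad(i=1,\dots,N-1)\qquad\text{and}\qquad \frac{f_N(a)}{(a_1\cdots a_N)^{1/(N-1)}}<\mu_0(S_{N-1})+\epsilon.$$ -/

import Mathlib

open scoped Pointwise

noncomputable section

/-- A lattice `L` is a covering lattice for the set `S` if the translates `S + l`, `l ∈ L`,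
cover the whole space. -/
def IsCoveringLattice {n : ℕ} (S : Set (Fin n → ℝ)) (L : Submodule ℤ (Fin n → ℝ)) : Prop :=
  ⋃ l ∈ L, (fun x => x + l) '' S = Set.univ

/-- The inhomogeneous minimum `μ(S, L)`: the infimum of all `σ > 0` such that `L` is a covering
lattice for `σ S`. If `S` has inner points and `L` is a full lattice, such `σ` exist. -/
def inhomogeneousMinimum {n : ℕ} (S : Set (Fin n → ℝ)) (L : Submodule ℤ (Fin n → ℝ)) : ℝ :=
  sInf {σ : ℝ | 0 < σ ∧ IsCoveringLattice (σ • S) L}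

/-- The absolute inhomogeneous minimum `μ₀(S)`: the infimum of `μ(S, L)` over all (full rank)
lattices `L` of determinant `1`. The determinant of a lattice is its covolume with respect to
Lebesgue measure. -/
def absoluteInhomogeneousMinimum {n : ℕ} (S : Set (Fin n → ℝ)) : ℝ :=
  sInf {m : ℝ | ∃ (L : Submodule ℤ (Fin n → ℝ)) (_ : DiscreteTopology L) (_ : IsZLattice ℝ L),
    ZLattice.covolume L MeasureTheory.volume = 1 ∧ m = inhomogeneousMinimum S L}

/-- The standard simplex in `ℝⁿ`. -/
def standardSimplex (n : ℕ) : Set (Fin n → ℝ) :=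
  {x | (∀ i, 0 ≤ x i) ∧ ∑ i, x i ≤ 1}

/-- The Frobenius number of `a`: the largest integer that is not a non-negative integer
combination of the `a i`. It equals `-1` if some `a i` is `1`. -/
def frobeniusNumber {N : ℕ} (a : Fin N → ℕ) : ℤ :=
  sSup {m : ℤ | ¬ ∃ x : Fin N → ℕ, m = ∑ i, (a i : ℤ) * (x i : ℤ)}

/-- The function `f_N(a) = g_N(a) + ∑ a i`, where `g_N` is the Frobenius number. -/
def shiftedFrobeniusNumber {N : ℕ} (a : Fin N → ℕ) : ℤ :=
  frobeniusNumber a + ∑ i, (a i : ℤ)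

end

/-!
Write `A` for the last entry of `a` and `S` for the standard simplex in `ℝⁿ`. The link between the
Frobenius problem and coverings is Kannan's formula: `f(a)` is the least `σ` for which the
translates of `{x | 0 ≤ x, ∑ i, a i * x i ≤ σ}` by the congruence lattice
`L_a = {z ∈ ℤⁿ | ∑ i, a i * z i ≡ 0 (mod A)}` cover `ℝⁿ`
(`shiftedFrobeniusNumber_le_of_covering` and `exists_covering_shiftedFrobeniusNumber`).
The map `x ↦ (a i * x i)` turns these sets into `σ • S` and `L_a`, which has index `A` in `ℤⁿ`, into
a lattice whose determinant is the product of all entries of `a`. Rescaling to determinant `1`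
(`exists_covolume_eq_one_congruence_lattice`) gives the lower bound for `f(a)`.

For its sharpness let the rows of `B₀` span a lattice of determinant `1` whose inhomogeneous minimum
is almost optimal. If `B` is an integer matrix and `c` an integer column, then the absolute values
of the maximal minors of `[B | c]` form a vector `a` with last entry `|det B|` for which the row
lattice of `B` lies in `L_a`, and by Cramer's rule its ratios `a i / A` are the entries of the
solution `β` of `B β = c`. So it is enough to find `[B | c]` with coprime maximal minors, `β` near
`α` and `B * diagonal β` near a multiple of `B₀`. Both are continuous conditions on `[B | c]`, up to
scaling, at the real matrix `[B₀ * diagonal α⁻¹ | B₀ 1]`, so everything rests on the density of the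
multiples of integer matrices with coprime maximal minors (`exists_hasCoprimeMinors_smul_mem`).

To get this density, a given real matrix is first approximated by a rational one, and its square
part is brought into upper triangular form `H` by unimodular row operations. Then `T • [H | y] + E`
is used, where `T` is a large multiple of `det H` and `E` has ones at `(i, i + 1)` and zeros
elsewhere: its square part has determinant `Tⁿ det H`, all of whose prime factors divide `T`, while
the minor without the first column is `±1` modulo `T` (`hasCoprimeMinors_smul_add_shift`).
Finally, a lattice close to a covering lattice is again a covering lattice for a slightly larger
simplex (`exists_covering_mul`).
-/

/-! ### The Frobenius number and positive combinations -/

theorem exists_forall_ge_exists_eq_sum_mul {N : ℕ} {a : Fin N → ℕ}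
    (hgcd : Finset.univ.gcd a = 1) :
    ∃ k : ℕ, ∀ m ≥ k, ∃ x : Fin N → ℕ, m = ∑ i, a i * x i := by
  obtain ⟨k, hk⟩ := Nat.exists_mem_closure_of_ge (s := Set.range a)
  refine ⟨k, fun m hm => ?_⟩
  have h1 : Nat.setGcd (Set.range a) = 1 := by
    apply Nat.dvd_one.mp
    rw [← hgcd]
    exact Finset.dvd_gcd fun i _ => Nat.setGcd_dvd_of_mem ⟨i, rfl⟩
  obtain ⟨x, hx⟩ := AddSubmonoid.mem_closure_range_iff_of_fintype.mp
    (hk m hm (h1 ▸ one_dvd m))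
  exact ⟨x, by simp [hx, mul_comm]⟩

theorem isGreatest_frobeniusNumber {N : ℕ} {a : Fin N → ℕ} (hgcd : Finset.univ.gcd a = 1) :
    IsGreatest {m : ℤ | ¬ ∃ x : Fin N → ℕ, m = ∑ i, (a i : ℤ) * (x i : ℤ)}
      (frobeniusNumber a) := by
  have hne : {m : ℤ | ¬ ∃ x : Fin N → ℕ, m = ∑ i, (a i : ℤ) * (x i : ℤ)}.Nonempty := by
    refine ⟨-1, ?_⟩
    rintro ⟨x, hx⟩
    have : 0 ≤ ∑ i, (a i : ℤ) * (x i : ℤ) := Finset.sum_nonneg fun i _ => by positivity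
    omega
  have hbdd : BddAbove {m : ℤ | ¬ ∃ x : Fin N → ℕ, m = ∑ i, (a i : ℤ) * (x i : ℤ)} := by
    obtain ⟨k, hk⟩ := exists_forall_ge_exists_eq_sum_mul hgcd
    refine ⟨k, fun m hm => ?_⟩
    by_contra! hlt
    obtain ⟨x, hx⟩ := hk m.toNat (by omega)
    refine hm ⟨x, ?_⟩
    rw [← Int.toNat_of_nonneg (by omega : 0 ≤ m), hx]
    push_cast
    rfl
  exact ⟨Int.csSup_mem hne hbdd, fun m hm => le_csSup hbdd hm⟩

theorem exists_eq_sum_of_frobeniusNumber_lt {N : ℕ} {a : Fin N → ℕ}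
    (hgcd : Finset.univ.gcd a = 1) {m : ℤ} (hm : frobeniusNumber a < m) :
    ∃ x : Fin N → ℕ, m = ∑ i, (a i : ℤ) * (x i : ℤ) := by
  by_contra h
  exact hm.not_ge ((isGreatest_frobeniusNumber hgcd).2 h)

theorem neg_one_le_frobeniusNumber {N : ℕ} {a : Fin N → ℕ} (hgcd : Finset.univ.gcd a = 1) :
    -1 ≤ frobeniusNumber a := by
  refine (isGreatest_frobeniusNumber hgcd).2 ?_
  rintro ⟨x, hx⟩
  have : 0 ≤ ∑ i, (a i : ℤ) * (x i : ℤ) := Finset.sum_nonneg fun i _ => by positivity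
  omega

/-- Adding `1` to each coefficient turns non-negative combinations into positive ones, so the shift
by `∑ i, a i` turns the Frobenius number into its analogue for positive coefficients. -/
theorem isGreatest_shiftedFrobeniusNumber {N : ℕ} {a : Fin N → ℕ}
    (hgcd : Finset.univ.gcd a = 1) :
    IsGreatest {m : ℤ | ¬ ∃ x : Fin N → ℕ, (∀ i, 0 < x i) ∧
      m = ∑ i, (a i : ℤ) * (x i : ℤ)} (shiftedFrobeniusNumber a) := by
  constructor
  · rintro ⟨x, hx, h⟩
    refine (isGreatest_frobeniusNumber hgcd).1 ⟨fun i => x i - 1, ?_⟩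
    have : ∀ i, ((x i - 1 : ℕ) : ℤ) = x i - 1 := fun i => by have := hx i; omega
    simp only [this, mul_sub, mul_one, Finset.sum_sub_distrib]
    rw [← h, shiftedFrobeniusNumber]
    ring
  · intro m hm
    by_contra! hlt
    obtain ⟨x, hx⟩ := exists_eq_sum_of_frobeniusNumber_lt hgcd
      (m := m - ∑ i, (a i : ℤ)) (by rw [shiftedFrobeniusNumber] at hlt; omega)
    refine hm ⟨fun i => x i + 1, fun i => Nat.succ_pos _, ?_⟩
    push_cast
    simp only [mul_add, mul_one, Finset.sum_add_distrib]
    omega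

theorem shiftedFrobeniusNumber_pos {n : ℕ} {a : Fin (n + 1) → ℕ} (hn : 1 ≤ n)
    (ha : ∀ i, 0 < a i) (hgcd : Finset.univ.gcd a = 1) : 0 < shiftedFrobeniusNumber a := by
  have h1 := neg_one_le_frobeniusNumber hgcd
  have h2 : ∑ _i : Fin (n + 1), (1 : ℤ) ≤ ∑ i, (a i : ℤ) :=
    Finset.sum_le_sum fun i _ => by exact_mod_cast ha i
  simp at h2
  rw [shiftedFrobeniusNumber]
  omega

/-! ### Kannan's formula -/

theorem exists_natCast_dvd_sub_sum {n : ℕ} {a : Fin (n + 1) → ℕ}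
    (hgcd : Finset.univ.gcd a = 1) (m : ℤ) :
    ∃ y : Fin n → ℤ, (a (Fin.last n) : ℤ) ∣ m - ∑ i, (a i.castSucc : ℤ) * y i := by
  -- The difference of representations of two consecutive integers represents `1`.
  obtain ⟨x, hx⟩ := exists_eq_sum_of_frobeniusNumber_lt hgcd (lt_add_one (frobeniusNumber a))
  obtain ⟨x', hx'⟩ := exists_eq_sum_of_frobeniusNumber_lt hgcd
    (by omega : frobeniusNumber a < frobeniusNumber a + 2)
  refine ⟨fun i => m * (x' i.castSucc - x i.castSucc),
    m * (x' (Fin.last n) - x (Fin.last n)), ?_⟩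
  rw [Fin.sum_univ_castSucc] at hx hx'
  have : ∑ i : Fin n, (a i.castSucc : ℤ) * (m * (x' i.castSucc - x i.castSucc)) =
      m * (∑ i : Fin n, (a i.castSucc : ℤ) * x' i.castSucc
        - ∑ i : Fin n, (a i.castSucc : ℤ) * x i.castSucc) := by
    rw [← Finset.sum_sub_distrib, Finset.mul_sum]
    exact Finset.sum_congr rfl fun i _ => by ring
  rw [this]
  linear_combination m * hx' - m * hx

/-- One half of Kannan's formula: the translates of `σ` times the simplex
`{x | 0 ≤ x, ∑ i, a i * x i ≤ 1}` by the lattice of integer vectors `l` with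
`∑ i, a i * l i ≡ 0` modulo the last entry of `a` cover the space only if `f(a) ≤ σ`. -/
theorem shiftedFrobeniusNumber_le_of_covering {n : ℕ} {a : Fin (n + 1) → ℕ}
    (hgcd : Finset.univ.gcd a = 1) {σ : ℝ}
    (hσ : ∀ y : Fin n → ℝ, ∃ l : Fin n → ℤ,
      (a (Fin.last n) : ℤ) ∣ ∑ i, (a i.castSucc : ℤ) * l i ∧ (∀ i, (l i : ℝ) ≤ y i) ∧
        ∑ i, (a i.castSucc : ℝ) * (y i - l i) ≤ σ) :
    (shiftedFrobeniusNumber a : ℝ) ≤ σ := by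
  by_contra! hlt
  refine (isGreatest_shiftedFrobeniusNumber hgcd).1 ?_
  set m := shiftedFrobeniusNumber a
  obtain ⟨y, hy⟩ := exists_natCast_dvd_sub_sum hgcd m
  -- The integer point `y` is moved by a small `-θ` in each coordinate before it is covered, so that
  -- its integer residue gets strictly positive coordinates.
  obtain ⟨θ, hθ, hθ'⟩ : ∃ θ : ℝ, 0 < θ ∧ σ + θ * ∑ i : Fin n, (a i.castSucc : ℝ) < m := by
    have hs : 0 ≤ ∑ i : Fin n, (a i.castSucc : ℝ) := Finset.sum_nonneg fun i _ => by positivity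
    refine ⟨(m - σ) / (∑ i : Fin n, (a i.castSucc : ℝ) + 1), by
      apply div_pos <;> linarith, ?_⟩
    have : (m - σ) / (∑ i : Fin n, (a i.castSucc : ℝ) + 1) * ∑ i : Fin n, (a i.castSucc : ℝ)
        < m - σ := by
      rw [div_mul_eq_mul_div, div_lt_iff₀ (by linarith)]
      nlinarith
    linarith
  obtain ⟨l, hl, hle, hsum⟩ := hσ fun i => y i - θ
  have hpos : ∀ i, 0 < y i - l i := fun i => by
    have := hle i
    have : (l i : ℝ) < y i := by linarith
    have : l i < y i := by exact_mod_cast this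
    omega
  have hlt' : ∑ i, (a i.castSucc : ℤ) * (y i - l i) < m := by
    have : ∑ i, (a i.castSucc : ℝ) * (y i - l i) < m := by
      refine lt_of_le_of_lt ?_ hθ'
      calc ∑ i, (a i.castSucc : ℝ) * (y i - l i)
          = ∑ i, (a i.castSucc : ℝ) * (y i - θ - l i) + θ * ∑ i : Fin n, (a i.castSucc : ℝ) := by
            rw [Finset.mul_sum, ← Finset.sum_add_distrib]
            exact Finset.sum_congr rfl fun i _ => by ring
        _ ≤ _ := by linarith
    exact_mod_cast this
  obtain ⟨q, hq⟩ : (a (Fin.last n) : ℤ) ∣ m - ∑ i, (a i.castSucc : ℤ) * (y i - l i) := by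
    have : m - ∑ i, (a i.castSucc : ℤ) * (y i - l i) =
        m - ∑ i, (a i.castSucc : ℤ) * y i + ∑ i, (a i.castSucc : ℤ) * l i := by
      simp only [mul_sub, Finset.sum_sub_distrib]
      ring
    rw [this]
    exact dvd_add hy hl
  have hq0 : 0 < q := by
    have h1 : 0 < (a (Fin.last n) : ℤ) * q := by omega
    exact pos_of_mul_pos_right h1 (by positivity)
  refine ⟨Fin.snoc (α := fun _ => ℕ) (fun i => (y i - l i).toNat) q.toNat, fun i => ?_, ?_⟩
  · induction i using Fin.lastCases with
    | last => simpa using hq0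
    | cast i => simpa using hpos i
  · rw [Fin.sum_univ_castSucc]
    simp only [Fin.snoc_castSucc, Fin.snoc_last]
    rw [Int.toNat_of_nonneg hq0.le, ← hq]
    have : ∀ i, (((y i - l i).toNat : ℕ) : ℤ) = y i - l i := fun i =>
      Int.toNat_of_nonneg (hpos i).le
    simp only [this]
    ring

/-- The other half of Kannan's formula: with `σ = f(a)` the translates do cover the space. -/
theorem exists_covering_shiftedFrobeniusNumber {n : ℕ} {a : Fin (n + 1) → ℕ}
    (ha : ∀ i, 0 < a i) (hgcd : Finset.univ.gcd a = 1) (y : Fin n → ℝ) :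
    ∃ l : Fin n → ℤ, (a (Fin.last n) : ℤ) ∣ ∑ i, (a i.castSucc : ℤ) * l i ∧
      (∀ i, (l i : ℝ) ≤ y i) ∧
        ∑ i, (a i.castSucc : ℝ) * (y i - l i) ≤ shiftedFrobeniusNumber a := by
  set g := frobeniusNumber a with hg
  set A : ℤ := (a (Fin.last n) : ℤ) with hA
  have hA0 : 0 < A := by have := ha (Fin.last n); omega
  set s : ℤ := ∑ i, (a i.castSucc : ℤ) * ⌊y i⌋ with hs
  -- the element of `(g, g + A]` that is congruent to `s` modulo `A`
  set m : ℤ := g + 1 + (s - (g + 1)) % A with hm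
  have hm1 : g < m := by have := Int.emod_nonneg (s - (g + 1)) hA0.ne'; omega
  have hm2 : m ≤ g + A := by have := Int.emod_lt_of_pos (s - (g + 1)) hA0; omega
  have hm3 : A ∣ s - m := by
    have : s - m = s - (g + 1) - (s - (g + 1)) % A := by omega
    rw [this]
    exact Int.dvd_self_sub_emod
  obtain ⟨w, hw⟩ := exists_eq_sum_of_frobeniusNumber_lt hgcd hm1
  rw [Fin.sum_univ_castSucc, ← hA] at hw
  refine ⟨fun i => ⌊y i⌋ - w i.castSucc, ?_, fun i => ?_, ?_⟩
  · have : ∑ i, (a i.castSucc : ℤ) * (⌊y i⌋ - w i.castSucc) =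
        (s - m) + A * w (Fin.last n) := by
      simp only [mul_sub, Finset.sum_sub_distrib]
      linear_combination hw
    rw [this]
    exact dvd_add hm3 (dvd_mul_right _ _)
  · push_cast
    have := Int.floor_le (y i)
    have : (0 : ℝ) ≤ w i.castSucc := by positivity
    linarith
  · have h1 : ∑ i, (a i.castSucc : ℝ) * (y i - ((⌊y i⌋ - w i.castSucc : ℤ) : ℝ)) ≤
        ∑ i : Fin n, ((a i.castSucc : ℝ) * (w i.castSucc : ℝ) + (a i.castSucc : ℝ)) := by
      refine Finset.sum_le_sum fun i _ => ?_
      have h := (Int.lt_floor_add_one (y i)).le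
      have h' : (0 : ℝ) ≤ a i.castSucc := by positivity
      push_cast
      nlinarith
    have h2 : ∑ i : Fin n, ((a i.castSucc : ℤ) * (w i.castSucc : ℤ) + (a i.castSucc : ℤ)) ≤
        shiftedFrobeniusNumber a := by
      rw [shiftedFrobeniusNumber, Fin.sum_univ_castSucc, Finset.sum_add_distrib, ← hg, ← hA]
      have : 0 ≤ A * w (Fin.last n) := by positivity
      omega
    refine h1.trans ?_
    exact_mod_cast h2

/-! ### Inhomogeneous minima -/

theorem isCoveringLattice_smul_standardSimplex_iff {n : ℕ} {σ : ℝ} (hσ : 0 < σ)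
    {L : Submodule ℤ (Fin n → ℝ)} :
    IsCoveringLattice (σ • standardSimplex n) L ↔
      ∀ y : Fin n → ℝ, ∃ l ∈ L, (∀ i, l i ≤ y i) ∧ ∑ i, (y i - l i) ≤ σ := by
  rw [IsCoveringLattice, Set.eq_univ_iff_forall]
  refine forall_congr' fun y => ?_
  simp only [Set.mem_iUnion, exists_prop]
  refine exists_congr fun l => and_congr_right fun _ => ?_
  rw [Set.image_add_right, Set.mem_preimage, ← sub_eq_add_neg,
    Set.mem_smul_set_iff_inv_smul_mem₀ hσ.ne']
  simp only [standardSimplex, Set.mem_ofPred_eq, Pi.smul_apply, Pi.sub_apply, smul_eq_mul,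
    ← Finset.mul_sum]
  refine and_congr (forall_congr' fun i => ?_) ?_
  · rw [mul_nonneg_iff_of_pos_left (inv_pos.mpr hσ), sub_nonneg]
  · rw [inv_mul_le_iff₀ hσ, mul_one]

theorem inhomogeneousMinimum_nonneg {n : ℕ} (S : Set (Fin n → ℝ)) (L : Submodule ℤ (Fin n → ℝ)) :
    0 ≤ inhomogeneousMinimum S L :=
  Real.sInf_nonneg fun _ h => h.1.le

theorem absoluteInhomogeneousMinimum_le {n : ℕ} (S : Set (Fin n → ℝ))
    (L : Submodule ℤ (Fin n → ℝ)) [hd : DiscreteTopology L] [hL : IsZLattice ℝ L]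
    (hcov : ZLattice.covolume L MeasureTheory.volume = 1) :
    absoluteInhomogeneousMinimum S ≤ inhomogeneousMinimum S L := by
  refine csInf_le ⟨0, ?_⟩ ⟨L, hd, hL, hcov, rfl⟩
  rintro _ ⟨L', _, _, _, rfl⟩
  exact inhomogeneousMinimum_nonneg S L'

theorem inhomogeneousMinimum_le {n : ℕ} {S : Set (Fin n → ℝ)} {L : Submodule ℤ (Fin n → ℝ)} {σ : ℝ}
    (hσ : 0 < σ) (h : IsCoveringLattice (σ • S) L) : inhomogeneousMinimum S L ≤ σ :=
  csInf_le ⟨0, fun _ h => h.1.le⟩ ⟨hσ, h⟩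

/-! ### The lower bound -/

/-- The lattice of integer vectors `z` with `∑ i, a i * z i ≡ 0` modulo the last entry `A` of `a`
has index `A` in `ℤⁿ`; rescaling its coordinates by `a i / t` with `tⁿ = ∏ i, a i` makes its
determinant equal to `1`. -/
theorem exists_covolume_eq_one_congruence_lattice {n : ℕ} {a : Fin (n + 1) → ℕ}
    (ha : ∀ i, 0 < a i) (hgcd : Finset.univ.gcd a = 1) {t : ℝ} (ht : 0 < t)
    (htn : t ^ n = ∏ i, (a i : ℝ)) :
    ∃ (L : Submodule ℤ (Fin n → ℝ)) (_ : DiscreteTopology L) (_ : IsZLattice ℝ L),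
      ZLattice.covolume L MeasureTheory.volume = 1 ∧
        ∀ z : Fin n → ℤ, (a (Fin.last n) : ℤ) ∣ ∑ i, (a i.castSucc : ℤ) * z i →
          (fun i => (a i.castSucc : ℝ) / t * z i) ∈ L := by
  have hw : ∀ i : Fin n, (a i.castSucc : ℝ) / t ≠ 0 := fun i =>
    (div_pos (by exact_mod_cast ha i.castSucc) ht).ne'
  set A : ℕ := a (Fin.last n) with hA
  have hA0 : A ≠ 0 := (ha _).ne'
  let b : Module.Basis (Fin n) ℝ (Fin n → ℝ) :=
    (Pi.basisFun ℝ (Fin n)).isUnitSMul fun i => (hw i).isUnit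
  have hb : ∀ i, b i = Pi.single i ((a i.castSucc : ℝ) / t) := fun i => by
    ext j
    simp [b, Module.Basis.isUnitSMul_apply, Pi.single_apply]
  let φ : (Fin n → ℤ) →ₗ[ℤ] (Fin n → ℝ) :=
    { toFun := fun z i => (a i.castSucc : ℝ) / t * z i
      map_add' := fun x y => by ext i; simp [mul_add]
      map_smul' := fun c x => by ext i; simp; ring }
  have hφ : Function.Injective φ := fun x y hxy => by
    ext i
    have := congrFun hxy i
    exact_mod_cast mul_left_cancel₀ (hw i) this
  let ψ : (Fin n → ℤ) →ₗ[ℤ] ZMod A :=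
    { toFun := fun z => ((∑ i, (a i.castSucc : ℤ) * z i : ℤ) : ZMod A)
      map_add' := fun x y => by simp [mul_add, Finset.sum_add_distrib]
      map_smul' := fun c x => by
        simp only [Pi.smul_apply, smul_eq_mul, RingHom.id_apply, zsmul_eq_mul]
        rw [← Int.cast_mul, Finset.mul_sum]
        congr 1
        exact Finset.sum_congr rfl fun i _ => by ring }
  have hψ : Function.Surjective ψ := fun u => by
    obtain ⟨m, rfl⟩ := ZMod.intCast_surjective u
    obtain ⟨y, hy⟩ := exists_natCast_dvd_sub_sum hgcd m
    exact ⟨y, ((ZMod.intCast_eq_intCast_iff_dvd_sub _ _ _).mpr hy)⟩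
  let M : Submodule ℤ (Fin n → ℝ) := Submodule.span ℤ (Set.range b)
  have hM : M = (⊤ : Submodule ℤ (Fin n → ℤ)).map φ := by
    apply le_antisymm
    · refine Submodule.span_le.mpr ?_
      rintro _ ⟨i, rfl⟩
      refine ⟨Pi.single i 1, trivial, ?_⟩
      ext j
      rw [hb]
      by_cases h : j = i
      · subst h; simp [φ]
      · simp [φ, h]
    · rintro _ ⟨z, _, rfl⟩
      have : φ z = ∑ i, z i • b i := by
        ext j
        simp [φ, hb, Finset.sum_apply, Pi.single_apply, mul_comm]
      rw [this]
      exact Submodule.sum_mem _ fun i _ => Submodule.smul_mem _ _ (Submodule.subset_span ⟨i, rfl⟩)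
  let L : Submodule ℤ (Fin n → ℝ) := (LinearMap.ker ψ).map φ
  have hLM : L ≤ M := hM ▸ Submodule.map_mono le_top
  have hmem : ∀ z : Fin n → ℤ, (A : ℤ) ∣ ∑ i, (a i.castSucc : ℤ) * z i → φ z ∈ L := fun z hz =>
    ⟨z, (ZMod.intCast_zmod_eq_zero_iff_dvd _ _).mpr hz, rfl⟩
  have hdisc : DiscreteTopology L :=
    DiscreteTopology.of_subset (inferInstance : DiscreteTopology M) hLM
  have hlat : IsZLattice ℝ L := ⟨by
    rw [eq_top_iff, ← b.span_eq]
    refine Submodule.span_le.mpr ?_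
    rintro _ ⟨i, rfl⟩
    have h1 : φ (Pi.single i (A : ℤ)) ∈ L := hmem _ (by
      rw [Finset.sum_eq_single i (fun j _ hj => by simp [hj]) (by simp)]
      simp)
    have h2 : b i = (A : ℝ)⁻¹ • φ (Pi.single i (A : ℤ)) := by
      ext j
      rw [hb]
      by_cases h : j = i
      · subst h; simp [φ]; field_simp
      · simp [φ, h]
    rw [h2]
    exact Submodule.smul_mem _ _ (Submodule.subset_span h1)⟩
  refine ⟨L, hdisc, hlat, ?_, fun z hz => hmem z hz⟩
  have hcovM : ZLattice.covolume M MeasureTheory.volume =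
      (∏ i : Fin n, (a i.castSucc : ℝ)) / t ^ n := by
    rw [ZLattice.covolume_eq_measure_fundamentalDomain M MeasureTheory.volume
      (ZSpan.isAddFundamentalDomain b MeasureTheory.volume), ZSpan.volume_real_fundamentalDomain]
    have : Matrix.of b = Matrix.diagonal fun i : Fin n => (a i.castSucc : ℝ) / t := by
      ext i j
      rw [Matrix.of_apply, hb, Matrix.diagonal_apply, Pi.single_apply]
      simp [eq_comm]
    rw [this, Matrix.det_diagonal, Finset.prod_div_distrib, Finset.prod_const, Finset.card_univ,
      Fintype.card_fin, abs_of_nonneg (by positivity)]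
  have hidx : L.toAddSubgroup.relIndex M.toAddSubgroup = A := by
    have h1 : L.toAddSubgroup = (LinearMap.ker ψ).toAddSubgroup.map φ.toAddMonoidHom := rfl
    have h2 : M.toAddSubgroup = (⊤ : AddSubgroup (Fin n → ℤ)).map φ.toAddMonoidHom := by
      rw [hM]; rfl
    have h3 : (LinearMap.ker ψ).toAddSubgroup = ψ.toAddMonoidHom.ker := rfl
    rw [h1, h2, AddSubgroup.relIndex_map_map_of_injective _ _ hφ, AddSubgroup.relIndex_top_right,
      h3, AddSubgroup.index_ker, AddMonoidHom.range_eq_top.mpr hψ, AddSubgroup.card_top,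
      Nat.card_zmod]
  have h := ZLattice.covolume_div_covolume_eq_relIndex L M hLM
  have hp : 0 < ∏ i : Fin n, (a i.castSucc : ℝ) :=
    Finset.prod_pos fun i _ => by exact_mod_cast ha i.castSucc
  rw [hidx, hcovM, htn, Fin.prod_univ_castSucc, ← hA] at h
  have hA0' : (A : ℝ) ≠ 0 := by exact_mod_cast hA0
  field_simp at h
  exact h

theorem rpow_one_div_natCast_pow {n : ℕ} (hn : 1 ≤ n) {x : ℝ} (hx : 0 ≤ x) :
    (x ^ (1 / (n : ℝ))) ^ n = x := by
  rw [one_div, Real.rpow_inv_natCast_pow hx (by omega)]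

theorem absoluteInhomogeneousMinimum_le_shiftedFrobeniusNumber_div {n : ℕ} (hn : 1 ≤ n)
    {a : Fin (n + 1) → ℕ} (ha : ∀ i, 0 < a i) (hgcd : Finset.univ.gcd a = 1) :
    absoluteInhomogeneousMinimum (standardSimplex n) ≤
      (shiftedFrobeniusNumber a : ℝ) / (∏ i, (a i : ℝ)) ^ (1 / (n : ℝ)) := by
  have hprod : 0 < ∏ i, (a i : ℝ) := Finset.prod_pos fun i _ => by exact_mod_cast ha i
  set t : ℝ := (∏ i, (a i : ℝ)) ^ (1 / (n : ℝ)) with htdef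
  have ht : 0 < t := Real.rpow_pos_of_pos hprod _
  obtain ⟨L, hd, hL, hcov, hmem⟩ := exists_covolume_eq_one_congruence_lattice ha hgcd ht
    (rpow_one_div_natCast_pow hn hprod.le)
  have hf : (0 : ℝ) < shiftedFrobeniusNumber a / t :=
    div_pos (by exact_mod_cast shiftedFrobeniusNumber_pos hn ha hgcd) ht
  refine (absoluteInhomogeneousMinimum_le _ L hcov).trans (inhomogeneousMinimum_le hf ?_)
  rw [isCoveringLattice_smul_standardSimplex_iff hf]
  intro y
  have ha' : ∀ i : Fin n, (0 : ℝ) < a i.castSucc := fun i => by exact_mod_cast ha i.castSucc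
  obtain ⟨l, hdvd, hle, hsum⟩ :=
    exists_covering_shiftedFrobeniusNumber ha hgcd fun i => y i * t / a i.castSucc
  refine ⟨_, hmem l hdvd, fun i => ?_, ?_⟩
  · have h1 : (a i.castSucc : ℝ) / t * l i ≤ a i.castSucc / t * (y i * t / a i.castSucc) :=
      mul_le_mul_of_nonneg_left (hle i) (div_pos (ha' i) ht).le
    refine h1.trans_eq ?_
    have := (ha' i).ne'
    field_simp
  · rw [le_div_iff₀ ht, Finset.sum_mul]
    refine le_of_eq_of_le (Finset.sum_congr rfl fun i _ => ?_) hsum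
    have := (ha' i).ne'
    field_simp

open Matrix Filter Topology

/-! ### Integer matrices with coprime maximal minors -/

/-- Every integer matrix with non-zero determinant is `W * H` with `W` invertible over `ℤ` and `H`
upper triangular. -/
theorem exists_unimodular_mul_upperTriangular {n : ℕ} (A : Matrix (Fin n) (Fin n) ℤ)
    (hA : A.det ≠ 0) :
    ∃ W V H : Matrix (Fin n) (Fin n) ℤ, V * W = 1 ∧ A = W * H ∧ H.BlockTriangular id := by
  -- `Λ` is the row lattice of `A`; the `i`-th row of `H` generates the `i`-th coordinates of the
  -- vectors of `Λ` whose earlier coordinates vanish.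
  let Λ : Submodule ℤ (Fin n → ℤ) := Submodule.span ℤ (Set.range A)
  have hmem : ∀ x, x ∈ Λ ↔ ∃ w : Fin n → ℤ, w ᵥ* A = x := fun x => by
    refine (Submodule.mem_span_range_iff_exists_fun ℤ).trans (exists_congr fun w => by
    rw [Matrix.vecMul_eq_sum])
  let F : Fin n → Submodule ℤ (Fin n → ℤ) := fun i =>
    Λ ⊓ { carrier := {x | ∀ j < i, x j = 0}
          add_mem' := fun {x y} hx hy j hj => by simp [hx j hj, hy j hj]
          zero_mem' := fun j _ => rfl
          smul_mem' := fun c x hx j hj => by simp [hx j hj] }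
  have hv : ∀ i, ∃ v ∈ F i, ∀ x ∈ F i, v i ∣ x i := fun i => by
    let I : Ideal ℤ := (F i).map (LinearMap.proj i)
    obtain ⟨g, hg⟩ := (IsPrincipalIdealRing.principal I).principal
    have hgI : g ∈ I := by rw [hg]; exact Submodule.mem_span_singleton_self g
    obtain ⟨v, hv, hvg⟩ := hgI
    refine ⟨v, hv, fun x hx => ?_⟩
    have hxI : x i ∈ I := ⟨x, hx, rfl⟩
    rw [hg] at hxI
    have : v i = g := hvg
    rw [this]
    exact Ideal.mem_span_singleton.mp hxI
  choose v hvF hvdvd using hv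
  let H : Matrix (Fin n) (Fin n) ℤ := Matrix.of v
  have hspan : ∀ k ≤ n, ∀ x ∈ Λ, (∀ j : Fin n, (j : ℕ) < n - k → x j = 0) →
      ∃ w : Fin n → ℤ, w ᵥ* H = x := by
    intro k
    induction k with
    | zero =>
      intro _ x _ h0
      exact ⟨0, by ext j; simp [h0 j (by simp)]⟩
    | succ k ih =>
      intro hk x hx h0
      let i : Fin n := ⟨n - (k + 1), by omega⟩
      obtain ⟨q, hq⟩ := hvdvd i x ⟨hx, fun j hj => h0 j hj⟩
      obtain ⟨w, hw⟩ := ih (by omega) (x - q • v i)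
        (Λ.sub_mem hx (Λ.smul_mem q (hvF i).1)) (fun j hj => by
          rcases lt_or_eq_of_le (by change (j : ℕ) ≤ n - (k + 1); omega : j ≤ i) with h | rfl
          · simp [h0 j h, (hvF i).2 j h]
          · simp [hq, mul_comm])
      refine ⟨w + Pi.single i q, ?_⟩
      rw [Matrix.add_vecMul, hw, Matrix.single_vecMul]
      ext j
      simp [H, Matrix.row]
  have hW : ∀ i, ∃ w : Fin n → ℤ, w ᵥ* H = A i := fun i =>
    hspan n le_rfl (A i) (Submodule.subset_span ⟨i, rfl⟩) (fun j hj => by omega)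
  have hV : ∀ i, ∃ w : Fin n → ℤ, w ᵥ* A = H i := fun i => (hmem _).mp (hvF i).1
  choose W hW using hW
  choose V hV using hV
  have hWH : A = Matrix.of W * H := by
    ext i j
    rw [← hW i, Matrix.mul_apply_eq_vecMul]
    rfl
  have hVA : H = Matrix.of V * A := by
    ext i j
    rw [← hV i, Matrix.mul_apply_eq_vecMul]
    rfl
  refine ⟨Matrix.of W, Matrix.of V, H, ?_, hWH, fun i j hij => (hvF i).2 j hij⟩
  have h1 : (Matrix.of W * Matrix.of V - 1) * A = 0 := by
    rw [sub_mul, one_mul, mul_assoc, ← hVA, ← hWH, sub_self]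
  have h2 : Matrix.of W * Matrix.of V - 1 = 0 := by
    have h3 : A.det • (Matrix.of W * Matrix.of V - 1) = 0 := by
      have := congrArg (· * A.adjugate) h1
      simpa only [mul_assoc, Matrix.mul_adjugate, zero_mul, Matrix.mul_smul, mul_one] using this
    exact (smul_eq_zero.mp h3).resolve_left hA
  exact mul_eq_one_comm.mp (sub_eq_zero.mp h2)

/-- For a square matrix `B` and a column `c`, the maximal minors `det B` and `cramer B c i` of the
matrix `[B | c]` have no common prime factor. -/
def HasCoprimeMinors {n : ℕ} (B : Matrix (Fin n) (Fin n) ℤ) (c : Fin n → ℤ) : Prop :=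
  ∀ p : ℕ, p.Prime → (p : ℤ) ∣ B.det → ¬ ∀ i, (p : ℤ) ∣ B.cramer c i

theorem HasCoprimeMinors.mul_left {n : ℕ} {B W V : Matrix (Fin n) (Fin n) ℤ} {c : Fin n → ℤ}
    (h : HasCoprimeMinors B c) (hVW : V * W = 1) : HasCoprimeMinors (W * B) (W *ᵥ c) := by
  have hdet : V.det * W.det = 1 := by rw [← Matrix.det_mul, hVW, Matrix.det_one]
  have hdvd : ∀ p z : ℤ, p ∣ W.det * z → p ∣ z := fun p z hz => by
    have : z = V.det * (W.det * z) := by rw [← mul_assoc, hdet, one_mul]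
    rw [this]
    exact hz.mul_left _
  intro p hp hpdet hall
  refine h p hp (hdvd _ _ (by rwa [← Matrix.det_mul])) fun i => hdvd _ _ ?_
  have : (W * B).cramer (W *ᵥ c) = W.det • B.cramer c := by
    rw [Matrix.cramer_eq_adjugate_mulVec, Matrix.adjugate_mul_distrib, Matrix.mulVec_mulVec,
      mul_assoc, Matrix.adjugate_mul, Matrix.cramer_eq_adjugate_mulVec, Matrix.mul_smul,
      Matrix.mul_one, Matrix.smul_mulVec]
  have h2 := hall i
  rwa [this] at h2

/-- Let `P` be the permutation matrix of the cyclic shift, with ones at `(i, i + 1)`. Moving its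
column `0` to the last place, and leaving zeros behind, gives the `n × (n + 1)` matrix `[E | e]`
with ones at `(i, i + 1)` and zeros elsewhere. If `H` is upper triangular, then so is `T • H + E`,
with the diagonal of `T • H`, while the minor of `[T • H + E | T • y + e]` in which `T • y + e`
replaces column `0` is `det P = ±1` modulo `T`. -/
theorem hasCoprimeMinors_smul_add_shift {k : ℕ} {H : Matrix (Fin (k + 1)) (Fin (k + 1)) ℤ}
    (hH : H.BlockTriangular id) (y : Fin (k + 1) → ℤ) {T : ℤ} (hT : H.det ∣ T) (hT0 : T ≠ 0)
    (hdet : H.det ≠ 0) :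
    let P : Matrix (Fin (k + 1)) (Fin (k + 1)) ℤ := (finRotate (k + 1)).permMatrix ℤ
    (T • H + P.updateCol 0 0).det ≠ 0 ∧
      HasCoprimeMinors (T • H + P.updateCol 0 0) (T • y + P.col 0) := by
  intro P
  have hP : ∀ i j, P i j = if i + 1 = j then 1 else 0 := fun i j => by
    simp [P, Equiv.Perm.permMatrix, PEquiv.toMatrix_apply, eq_comm]
  have hE : ∀ i j, j ≤ i → P.updateCol 0 0 i j = 0 := fun i j hji => by
    rw [Matrix.updateCol_apply]
    split_ifs with h
    · rfl
    · rw [hP, if_neg]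
      rintro rfl
      by_cases hi : i = Fin.last k
      · simp [hi] at h
      · have := Fin.lt_add_one_iff.mpr (Fin.lt_last_iff_ne_last.mpr hi)
        exact this.not_ge hji
  have htri : (T • H + P.updateCol 0 0).BlockTriangular id := fun i j hij => by
    have h1 : H i j = 0 := hH hij
    simp only [Matrix.add_apply, Matrix.smul_apply, h1, hE i j (le_of_lt hij), smul_zero, add_zero]
  have hdetB : (T • H + P.updateCol 0 0).det = T ^ (k + 1) * H.det := by
    rw [Matrix.det_of_isUpperTriangular htri, Matrix.det_of_isUpperTriangular hH]
    simp only [Matrix.add_apply, Matrix.smul_apply, hE _ _ le_rfl, add_zero, smul_eq_mul,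
      Finset.prod_mul_distrib, Finset.prod_const, Finset.card_univ, Fintype.card_fin]
  refine ⟨by rw [hdetB]; exact mul_ne_zero (pow_ne_zero _ hT0) hdet, fun p hp hpd hall => ?_⟩
  have hp' : Prime (p : ℤ) := Nat.prime_iff_prime_int.mp hp
  have hpT : (p : ℤ) ∣ T := by
    rw [hdetB] at hpd
    rcases hp'.dvd_or_dvd hpd with h | h
    · exact hp'.dvd_of_dvd_pow h
    · exact h.trans hT
  have h0 := hall 0
  rw [Matrix.cramer_apply, ← ZMod.intCast_zmod_eq_zero_iff_dvd, Int.cast_det] at h0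
  have hTp : (T : ZMod p) = 0 := (ZMod.intCast_zmod_eq_zero_iff_dvd _ _).mpr hpT
  have hred : ((T • H + P.updateCol 0 0).updateCol 0 (T • y + P.col 0)).map
      (Int.cast : ℤ → ZMod p) = P.map (Int.cast : ℤ → ZMod p) := by
    ext i j
    by_cases hj : j = 0
    · subst hj
      simp [hTp]
    · simp [-zsmul_eq_mul, hj, hTp]
  rw [hred, ← Int.cast_det, ZMod.intCast_zmod_eq_zero_iff_dvd, Matrix.det_permutation] at h0
  rcases Int.units_eq_one_or (Equiv.Perm.sign (finRotate (k + 1))) with h | h <;>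
    rw [h] at h0
  · exact hp'.not_dvd_one (by simpa using h0)
  · exact hp'.not_dvd_one (by simpa using h0)

/-- Real multiples of integer matrices `[B | c]` with coprime maximal minors are dense. -/
theorem exists_hasCoprimeMinors_smul_mem {k : ℕ} {X : Matrix (Fin (k + 1)) (Fin (k + 1)) ℝ}
    (hX : X.det ≠ 0) (z : Fin (k + 1) → ℝ)
    {p : Matrix (Fin (k + 1)) (Fin (k + 1)) ℝ × (Fin (k + 1) → ℝ) → Prop}
    (hp : ∀ᶠ q in 𝓝 (X, z), p q) :
    ∃ s : ℝ, 0 < s ∧ ∃ (B : Matrix (Fin (k + 1)) (Fin (k + 1)) ℤ) (c : Fin (k + 1) → ℤ),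
      B.det ≠ 0 ∧ HasCoprimeMinors B c ∧
        p (s • B.map (Int.cast : ℤ → ℝ), s • fun i => (c i : ℝ)) := by
  -- Rounding gives a rational matrix `[A | y] / m` near `[X | z]`.
  have hround : ∀ x : ℝ, Tendsto (fun m : ℕ => (m : ℝ)⁻¹ * (⌊(m : ℝ) * x⌋ : ℝ)) atTop (𝓝 x) := by
    intro x
    have hinv : Tendsto (fun m : ℕ => (m : ℝ)⁻¹) atTop (𝓝 0) := tendsto_inv_atTop_nhds_zero_nat
    refine tendsto_of_tendsto_of_tendsto_of_le_of_le' (by simpa using hinv.const_sub x)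
      tendsto_const_nhds ?_ ?_ <;> filter_upwards [eventually_gt_atTop 0] with m hm <;>
      have hm' : (0 : ℝ) < m := by exact_mod_cast hm
    · have := (Int.lt_floor_add_one ((m : ℝ) * x)).le
      have h2 : (m : ℝ)⁻¹ * (m * x) ≤ (m : ℝ)⁻¹ * (⌊(m : ℝ) * x⌋ + 1) := by gcongr
      rw [inv_mul_cancel_left₀ hm'.ne'] at h2
      linarith
    · have := Int.floor_le ((m : ℝ) * x)
      have h2 : (m : ℝ)⁻¹ * ⌊(m : ℝ) * x⌋ ≤ (m : ℝ)⁻¹ * (m * x) := by gcongr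
      rwa [inv_mul_cancel_left₀ hm'.ne'] at h2
  have hlim : Tendsto (fun m : ℕ => ((m : ℝ)⁻¹ • (X.map fun x => (⌊(m : ℝ) * x⌋ : ℝ)),
      (m : ℝ)⁻¹ • fun i => (⌊(m : ℝ) * z i⌋ : ℝ))) atTop (𝓝 (X, z)) := by
    refine Tendsto.prodMk_nhds ?_ ?_
    · exact tendsto_pi_nhds.mpr fun i => tendsto_pi_nhds.mpr fun j => hround (X i j)
    · exact tendsto_pi_nhds.mpr fun i => hround (z i)
  have hdet : ∀ᶠ q : Matrix (Fin (k + 1)) (Fin (k + 1)) ℝ × (Fin (k + 1) → ℝ) in 𝓝 (X, z),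
      q.1.det ≠ 0 :=
    (continuous_fst.matrix_det.continuousAt (x := (X, z))).eventually_ne hX
  obtain ⟨m, ⟨hm1, hm2⟩, hm0⟩ := ((hlim.eventually (hp.eventually_nhds.and hdet)).and
    (eventually_gt_atTop 0)).exists
  have hm0' : (0 : ℝ) < m := by exact_mod_cast hm0
  set A : Matrix (Fin (k + 1)) (Fin (k + 1)) ℤ := X.map fun x => ⌊(m : ℝ) * x⌋ with hA
  set y : Fin (k + 1) → ℤ := fun i => ⌊(m : ℝ) * z i⌋ with hy
  have hA0 : A.det ≠ 0 := by
    intro h0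
    apply hm2
    change ((m : ℝ)⁻¹ • A.map (Int.cast : ℤ → ℝ)).det = 0
    rw [Matrix.det_smul, ← Int.cast_det, h0]
    simp
  obtain ⟨W, V, H, hVW, hWH, hH⟩ := exists_unimodular_mul_upperTriangular A hA0
  have hH0 : H.det ≠ 0 := fun h0 => hA0 (by rw [hWH, Matrix.det_mul, h0, mul_zero])
  set P : Matrix (Fin (k + 1)) (Fin (k + 1)) ℤ := (finRotate (k + 1)).permMatrix ℤ with hP
  have hWV : W * V = 1 := mul_eq_one_comm.mp hVW
  -- The perturbation of `[T • A | T • y]` is of bounded size as `T` grows.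
  have hlim2 : Tendsto (fun r : ℝ => ((m : ℝ)⁻¹ • (A.map (Int.cast : ℤ → ℝ) +
      r • (W * P.updateCol 0 0).map (Int.cast : ℤ → ℝ)),
      (m : ℝ)⁻¹ • ((fun i => (y i : ℝ)) + r • fun i => ((W *ᵥ P.col 0) i : ℝ)))) (𝓝 0)
      (𝓝 ((m : ℝ)⁻¹ • (A.map (Int.cast : ℤ → ℝ)), (m : ℝ)⁻¹ • fun i => (y i : ℝ))) := by
    apply Continuous.tendsto'
    · fun_prop
    · simp
  have hT : Tendsto (fun j : ℕ => (((j : ℝ) + 1) * |(H.det : ℝ)|)⁻¹) atTop (𝓝 0) := by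
    apply Tendsto.inv_tendsto_atTop
    apply Tendsto.atTop_mul_const (by positivity)
    exact tendsto_atTop_add_const_right _ _ tendsto_natCast_atTop_atTop
  obtain ⟨j, hj⟩ := ((hlim2.comp hT).eventually hm1).exists
  set T : ℤ := (j + 1) * |H.det| with hTdef
  have hTpos : 0 < T := by positivity
  obtain ⟨hB0, hBc⟩ := hasCoprimeMinors_smul_add_shift hH (V *ᵥ y) (T := T)
    ((dvd_abs _ _).mpr dvd_rfl |>.mul_left _) hTpos.ne' hH0
  have hTR : (0 : ℝ) < T := by exact_mod_cast hTpos
  have hTcast : ((j : ℝ) + 1) * |(H.det : ℝ)| = T := by simp [hTdef]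
  rw [Function.comp_apply, hTcast] at hj
  refine ⟨(m : ℝ)⁻¹ * (T : ℝ)⁻¹, by positivity, W * (T • H + P.updateCol 0 0),
    W *ᵥ (T • (V *ᵥ y) + P.col 0), ?_, hBc.mul_left hVW, ?_⟩
  · rw [Matrix.det_mul]
    refine mul_ne_zero (fun h0 => ?_) hB0
    have := congrArg Matrix.det hVW
    rw [Matrix.det_mul, h0] at this
    simp at this
  · convert hj using 2
    · rw [mul_smul]
      congr 1
      rw [Matrix.mul_add, Matrix.mul_smul, ← hWH]
      ext i l
      simp [-zsmul_eq_mul, mul_add, hTR.ne']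
    · rw [mul_smul]
      congr 1
      rw [Matrix.mulVec_add, Matrix.mulVec_smul, Matrix.mulVec_mulVec, hWV, Matrix.one_mulVec]
      ext i
      simp [mul_add, hTR.ne']

/-! ### Covering lattices and their perturbations -/

theorem exists_isCoveringLattice_smul_standardSimplex {n : ℕ} (L : Submodule ℤ (Fin n → ℝ))
    [DiscreteTopology L] [IsZLattice ℝ L] :
    ∃ σ : ℝ, 0 < σ ∧ IsCoveringLattice (σ • standardSimplex n) L := by
  let b := (IsZLattice.basis L).ofZLatticeBasis ℝ L
  have hb : Submodule.span ℤ (Set.range b) = L := (IsZLattice.basis L).ofZLatticeBasis_span ℝ L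
  set R : ℝ := ∑ i, ‖b i‖ with hR
  have hR0 : 0 ≤ R := Finset.sum_nonneg fun i _ => norm_nonneg _
  have hσ : 0 < n * (2 * R) + 1 := by positivity
  refine ⟨n * (2 * R) + 1, hσ, ?_⟩
  rw [isCoveringLattice_smul_standardSimplex_iff hσ]
  intro y
  -- reduction modulo `L` moves a point into the cube `[-R, R]ⁿ`
  set x : Fin n → ℝ := y - fun _ => R with hx
  have hfr : ∀ i, |x i - (ZSpan.floor b x : Fin n → ℝ) i| ≤ R := fun i =>
    (norm_le_pi_norm (ZSpan.fract b x) i).trans (ZSpan.norm_fract_le b x)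
  have hbd : ∀ i, (ZSpan.floor b x : Fin n → ℝ) i ≤ y i ∧
      y i - (ZSpan.floor b x : Fin n → ℝ) i ≤ 2 * R := fun i => by
    have h1 := abs_le.mp (hfr i)
    have h2 : x i = y i - R := rfl
    constructor <;> linarith
  refine ⟨ZSpan.floor b x, hb ▸ (ZSpan.floor b x).2, fun i => (hbd i).1, ?_⟩
  calc ∑ i, (y i - (ZSpan.floor b x : Fin n → ℝ) i) ≤ ∑ _i : Fin n, 2 * R :=
        Finset.sum_le_sum fun i _ => (hbd i).2
    _ = n * (2 * R) := by simp
    _ ≤ _ := by linarith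

/-- A nearly optimal lattice of determinant `1`, given by a matrix `B` whose rows form a basis. -/
theorem exists_covering_matrix_lt_absoluteInhomogeneousMinimum_add {n : ℕ} {ε : ℝ}
    (hε : 0 < ε) :
    ∃ σ : ℝ, 0 < σ ∧ σ < absoluteInhomogeneousMinimum (standardSimplex n) + ε ∧
      ∃ B : Matrix (Fin n) (Fin n) ℝ, |B.det| = 1 ∧
        ∀ y : Fin n → ℝ, ∃ w : Fin n → ℤ, (∀ i, ((fun j => (w j : ℝ)) ᵥ* B) i ≤ y i) ∧
          ∑ i, (y i - ((fun j => (w j : ℝ)) ᵥ* B) i) ≤ σ := by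
  -- The two infima are over non-empty sets: there is a lattice of determinant `1`, and any lattice
  -- is a covering lattice for some multiple of the simplex.
  have hne : {m : ℝ | ∃ (L : Submodule ℤ (Fin n → ℝ)) (_ : DiscreteTopology L)
      (_ : IsZLattice ℝ L), ZLattice.covolume L MeasureTheory.volume = 1 ∧
        m = inhomogeneousMinimum (standardSimplex n) L}.Nonempty := by
    obtain ⟨L, hd, hL, hcov, -⟩ := exists_covolume_eq_one_congruence_lattice (n := n)
      (a := fun _ => 1) (fun _ => one_pos) (Nat.dvd_one.mp (Finset.gcd_dvd (Finset.mem_univ 0)))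
      (t := 1) one_pos (by simp)
    exact ⟨_, L, hd, hL, hcov, rfl⟩
  obtain ⟨_, ⟨L, _, _, hcov, rfl⟩, hlt⟩ := exists_lt_of_csInf_lt hne
    (show sInf _ < absoluteInhomogeneousMinimum (standardSimplex n) + ε from
      lt_add_of_pos_right _ hε)
  obtain ⟨σ, ⟨hσ, hσL⟩, hσlt⟩ := exists_lt_of_csInf_lt
    (exists_isCoveringLattice_smul_standardSimplex L) hlt
  let b := IsZLattice.basis L
  refine ⟨σ, hσ, hσlt, Matrix.of ((↑) ∘ b), ?_, fun y => ?_⟩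
  · rw [← ZLattice.covolume_eq_det, hcov]
  · obtain ⟨l, hl, hle, hsum⟩ := (isCoveringLattice_smul_standardSimplex_iff hσ).mp hσL y
    have hrow : (fun j => (b.repr ⟨l, hl⟩ j : ℝ)) ᵥ* Matrix.of ((↑) ∘ b) = l := by
      have h := congrArg (Subtype.val : L → (Fin n → ℝ)) (b.sum_repr ⟨l, hl⟩)
      rw [Matrix.vecMul_eq_sum]
      refine Eq.trans ?_ h
      rw [AddSubmonoidClass.coe_finsetSum]
      refine Finset.sum_congr rfl fun i _ => ?_
      ext j
      simp
    exact ⟨fun j => b.repr ⟨l, hl⟩ j, by rw [hrow]; exact ⟨hle, hsum⟩⟩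

/-- Applying a matrix `G` near `1` to a covering lattice costs little: `S * G` lies in the translate
by `-δ` in all coordinates of `(1 + (n + 1) * δ) • S`, where `δ` is the sum of the absolute values
of the entries of `G - 1`. -/
theorem exists_covering_mul {n : ℕ} {B G : Matrix (Fin n) (Fin n) ℝ} {σ : ℝ}
    (hB : ∀ y : Fin n → ℝ, ∃ w : Fin n → ℤ, (∀ i, ((fun j => (w j : ℝ)) ᵥ* B) i ≤ y i) ∧
      ∑ i, (y i - ((fun j => (w j : ℝ)) ᵥ* B) i) ≤ σ) (hG : G.det ≠ 0) (y : Fin n → ℝ) :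
    ∃ w : Fin n → ℤ, (∀ i, ((fun j => (w j : ℝ)) ᵥ* (B * G)) i ≤ y i) ∧
      ∑ i, (y i - ((fun j => (w j : ℝ)) ᵥ* (B * G)) i) ≤
        σ * (1 + (n + 1) * ∑ i, ∑ j, |(G - 1) i j|) := by
  set δ : ℝ := ∑ i, ∑ j, |(G - 1) i j| with hδ
  obtain ⟨w, hle, hsum⟩ := hB ((y - fun _ => σ * δ) ᵥ* G⁻¹)
  refine ⟨w, ?_⟩
  set τ : Fin n → ℝ := (y - fun _ => σ * δ) ᵥ* G⁻¹ - (fun j => (w j : ℝ)) ᵥ* B with hτ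
  have hτ0 : ∀ i, 0 ≤ τ i := fun i => sub_nonneg.mpr (hle i)
  have hτσ : ∑ i, τ i ≤ σ := hsum
  have hτi : ∀ i, τ i ≤ σ := fun i =>
    (Finset.single_le_sum (fun j _ => hτ0 j) (Finset.mem_univ i)).trans hτσ
  have hy : ∀ i, y i - ((fun j => (w j : ℝ)) ᵥ* (B * G)) i =
      τ i + (τ ᵥ* (G - 1)) i + σ * δ := fun i => by
    have h : τ ᵥ* G = (y - fun _ => σ * δ) - (fun j => (w j : ℝ)) ᵥ* (B * G) := by
      rw [hτ, Matrix.sub_vecMul, Matrix.vecMul_vecMul, Matrix.vecMul_vecMul,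
        Matrix.nonsing_inv_mul G hG.isUnit, Matrix.vecMul_one]
    have h2 := congrFun h i
    rw [Matrix.vecMul_sub, Matrix.vecMul_one, h]
    simp only [Pi.sub_apply]
    ring
  have habs : ∀ i, |(τ ᵥ* (G - 1)) i| ≤ σ * ∑ j, |(G - 1) j i| := fun i => by
    rw [Finset.mul_sum]
    have h : (τ ᵥ* (G - 1)) i = ∑ j, τ j * (G - 1) j i := rfl
    rw [h]
    refine (Finset.abs_sum_le_sum_abs _ _).trans (Finset.sum_le_sum fun j _ => ?_)
    rw [abs_mul, abs_of_nonneg (hτ0 j)]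
    exact mul_le_mul_of_nonneg_right (hτi j) (abs_nonneg _)
  have hsumabs : ∑ i, σ * ∑ j, |(G - 1) j i| = σ * δ := by
    rw [← Finset.mul_sum, hδ, Finset.sum_comm]
  refine ⟨fun i => ?_, ?_⟩
  · have hσ0 : 0 ≤ σ := (hτ0 i).trans (hτi i)
    have h1 : σ * ∑ j, |(G - 1) j i| ≤ σ * δ := by
      rw [← hsumabs]
      exact Finset.single_le_sum (f := fun i => σ * ∑ j, |(G - 1) j i|)
        (fun j _ => by positivity) (Finset.mem_univ i)
    have h2 := (abs_le.mp ((habs i).trans h1)).1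
    have := hy i
    have := hτ0 i
    linarith
  · simp only [hy, Finset.sum_add_distrib, Finset.sum_const, Finset.card_univ, Fintype.card_fin,
      nsmul_eq_mul]
    have : ∑ i, (τ ᵥ* (G - 1)) i ≤ σ * δ := by
      rw [← hsumabs]
      exact Finset.sum_le_sum fun i _ => (le_abs_self _).trans (habs i)
    linarith

/-! ### Simultaneous approximation of a lattice and a vector -/

/-- The solution `β` of `X β = z` for `q = (X, z)`, by Cramer's rule. -/
noncomputable def cramerSolution {n : ℕ} (q : Matrix (Fin n) (Fin n) ℝ × (Fin n → ℝ)) : Fin n → ℝ :=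
  q.1.det⁻¹ • (q.1.adjugate *ᵥ q.2)

theorem cramerSolution_mulVec {n : ℕ} {X : Matrix (Fin n) (Fin n) ℝ} (hX : X.det ≠ 0)
    (α : Fin n → ℝ) : cramerSolution (X, X *ᵥ α) = α := by
  simp only [cramerSolution]
  rw [Matrix.mulVec_mulVec, Matrix.adjugate_mul, Matrix.smul_mulVec, Matrix.one_mulVec,
    smul_smul, inv_mul_cancel₀ hX, one_smul]

theorem continuousAt_cramerSolution {n : ℕ} {q : Matrix (Fin n) (Fin n) ℝ × (Fin n → ℝ)}
    (hq : q.1.det ≠ 0) : ContinuousAt cramerSolution q := by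
  have h1 : ContinuousAt
      (fun q : Matrix (Fin n) (Fin n) ℝ × (Fin n → ℝ) => q.1.det⁻¹) q :=
    ContinuousAt.inv₀ continuous_fst.matrix_det.continuousAt hq
  have h2 : Continuous
      (fun q : Matrix (Fin n) (Fin n) ℝ × (Fin n → ℝ) => q.1.adjugate *ᵥ q.2) :=
    continuous_fst.matrix_adjugate.matrix_mulVec continuous_snd
  exact h1.smul h2.continuousAt

theorem cramerSolution_smul_mul_det {k : ℕ} {s : ℝ} (hs : s ≠ 0)
    {B : Matrix (Fin (k + 1)) (Fin (k + 1)) ℤ} (hB : B.det ≠ 0) (c : Fin (k + 1) → ℤ)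
    (i : Fin (k + 1)) :
    cramerSolution (s • B.map (Int.cast : ℤ → ℝ), s • fun i => (c i : ℝ)) i * (B.det : ℝ) =
      B.cramer c i := by
  have hBR : (B.det : ℝ) ≠ 0 := by exact_mod_cast hB
  have hdetB : (B.map (Int.cast : ℤ → ℝ)).det = B.det := (Int.cast_det B).symm
  have hadj : (B.map (Int.cast : ℤ → ℝ)).adjugate = B.adjugate.map (Int.cast : ℤ → ℝ) :=
    ((Int.castRingHom ℝ).map_adjugate B).symm
  have hcr : ((B.map (Int.cast : ℤ → ℝ)).adjugate *ᵥ fun i => (c i : ℝ)) i = B.cramer c i := by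
    rw [hadj, Matrix.cramer_eq_adjugate_mulVec]
    simp [Matrix.mulVec, dotProduct]
  simp only [cramerSolution, Matrix.det_smul, Matrix.adjugate_smul, hdetB, Matrix.smul_mulVec,
    Matrix.mulVec_smul, hcr, Fintype.card_fin, Pi.smul_apply, smul_eq_mul, Nat.add_sub_cancel]
  field_simp
  ring

/-- Any lattice and any vector `α` with positive entries are approximated at once: there are
integer matrices `[B | c]` with coprime maximal minors for which the solution `β` of `B β = c` is
near `α`, and the rows of `B * diagonal β`, after scaling, are near those of `B₀`. -/
theorem exists_hasCoprimeMinors_near {k : ℕ} {B₀ : Matrix (Fin (k + 1)) (Fin (k + 1)) ℝ}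
    (hB₀ : B₀.det ≠ 0) {α : Fin (k + 1) → ℝ} (hα : ∀ i, α i ≠ 0)
    {p : (Fin (k + 1) → ℝ) → Prop} (hp : ∀ᶠ β in 𝓝 α, p β)
    {p' : Matrix (Fin (k + 1)) (Fin (k + 1)) ℝ → Prop} (hp' : ∀ᶠ G in 𝓝 1, p' G) :
    ∃ s : ℝ, 0 < s ∧ ∃ (B : Matrix (Fin (k + 1)) (Fin (k + 1)) ℤ) (c : Fin (k + 1) → ℤ)
      (β : Fin (k + 1) → ℝ) (G : Matrix (Fin (k + 1)) (Fin (k + 1)) ℝ),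
      B.det ≠ 0 ∧ HasCoprimeMinors B c ∧ (∀ i, β i * (B.det : ℝ) = B.cramer c i) ∧
        B₀ * G = s • (B.map (Int.cast : ℤ → ℝ) * Matrix.diagonal β) ∧ p β ∧ p' G := by
  set X₀ := B₀ * Matrix.diagonal fun i => (α i)⁻¹ with hX₀
  have hX₀0 : X₀.det ≠ 0 := by
    rw [hX₀, Matrix.det_mul, Matrix.det_diagonal]
    exact mul_ne_zero hB₀ (Finset.prod_ne_zero_iff.mpr fun i _ => inv_ne_zero (hα i))
  have hβ0 := cramerSolution_mulVec hX₀0 α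
  have hβ : Tendsto cramerSolution (𝓝 (X₀, X₀ *ᵥ α)) (𝓝 α) := by
    have h : ContinuousAt cramerSolution (X₀, X₀ *ᵥ α) := continuousAt_cramerSolution hX₀0
    rwa [ContinuousAt, hβ0] at h
  have hG : Tendsto (fun q => B₀⁻¹ * (q.1 * Matrix.diagonal (cramerSolution q)))
      (𝓝 (X₀, X₀ *ᵥ α)) (𝓝 1) := by
    have h1 : Continuous fun q : Matrix (Fin (k + 1)) (Fin (k + 1)) ℝ × (Fin (k + 1) → ℝ) =>
        B₀⁻¹ * (q.1 * Matrix.diagonal q.2) :=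
      continuous_const.matrix_mul (continuous_fst.matrix_mul continuous_snd.matrix_diagonal)
    have h2 : B₀⁻¹ * (X₀ * Matrix.diagonal α) = 1 := by
      rw [hX₀, mul_assoc, Matrix.diagonal_mul_diagonal, ← mul_assoc,
        Matrix.nonsing_inv_mul _ hB₀.isUnit, one_mul]
      simp [hα]
    have h3 := (h1.tendsto (X₀, α)).comp
      (((continuous_fst.tendsto (X₀, X₀ *ᵥ α))).prodMk_nhds hβ)
    rw [h2] at h3
    exact h3
  obtain ⟨s, hs, B, c, hB, hBc, h1, h2⟩ :=
    exists_hasCoprimeMinors_smul_mem hX₀0 (X₀ *ᵥ α) ((hβ.eventually hp).and (hG.eventually hp'))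
  refine ⟨s, hs, B, c, _, _, hB, hBc, cramerSolution_smul_mul_det hs.ne' hB c, ?_, h1, h2⟩
  rw [← mul_assoc, Matrix.mul_nonsing_inv _ hB₀.isUnit, one_mul, Matrix.smul_mul]

/-! ### Sharpness -/

/-- Let `a` consist of the absolute values of the maximal minors of `[B | c]`, and let the solution
`β` of `B β = c` be positive. The row lattice of `B` lies in the congruence lattice of `a`, so if
the row lattice of `B * diagonal β` covers the space by translates of `ρ` times the standard
simplex, then `f(a) ≤ |det B| * ρ`. -/
theorem exists_shiftedFrobeniusNumber_le_of_hasCoprimeMinors {n : ℕ}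
    {B : Matrix (Fin n) (Fin n) ℤ} {c : Fin n → ℤ}
    (hB : B.det ≠ 0) (hBc : HasCoprimeMinors B c) {β : Fin n → ℝ} (hβ : ∀ i, 0 < β i)
    (hβB : ∀ i, β i * (B.det : ℝ) = B.cramer c i) {ρ : ℝ}
    (hcov : ∀ y : Fin n → ℝ, ∃ w : Fin n → ℤ, (∀ i, β i * ((w ᵥ* B) i : ℝ) ≤ y i) ∧
      ∑ i, (y i - β i * ((w ᵥ* B) i : ℝ)) ≤ ρ) :
    ∃ a : Fin (n + 1) → ℕ, Finset.univ.gcd a = 1 ∧ (a (Fin.last n) : ℝ) = |(B.det : ℝ)| ∧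
      (∀ i : Fin n, (a i.castSucc : ℝ) = β i * |(B.det : ℝ)|) ∧
      (shiftedFrobeniusNumber a : ℝ) ≤ |(B.det : ℝ)| * ρ := by
  set d : ℤ := B.det with hd
  set u : Fin n → ℤ := B.cramer c with hu
  have hdR : (0 : ℝ) < |(d : ℝ)| := abs_pos.mpr (by exact_mod_cast hB)
  set a : Fin (n + 1) → ℕ := Fin.snoc (α := fun _ => ℕ) (fun i => (u i).natAbs) d.natAbs with ha
  have halast : a (Fin.last n) = d.natAbs := by simp [ha]
  have hacast : ∀ i : Fin n, a i.castSucc = (u i).natAbs := fun i => by simp [ha]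
  have hlast : (a (Fin.last n) : ℝ) = |(d : ℝ)| := by
    rw [halast, Nat.cast_natAbs, Int.cast_abs]
  have hcast : ∀ i : Fin n, (a i.castSucc : ℝ) = β i * |(d : ℝ)| := fun i => by
    rw [hacast, Nat.cast_natAbs, Int.cast_abs, ← hβB, abs_mul, abs_of_pos (hβ i)]
  have hgcd : Finset.univ.gcd a = 1 := by
    by_contra h
    obtain ⟨p, hp, hpd⟩ := Nat.exists_prime_and_dvd h
    have hall : ∀ i, p ∣ a i := fun i => hpd.trans (Finset.gcd_dvd (Finset.mem_univ i))
    refine hBc p hp (Int.natCast_dvd.mpr (halast ▸ hall _)) fun i => ?_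
    exact Int.natCast_dvd.mpr (hacast i ▸ hall i.castSucc)
  -- Since `β` is positive, the minors `u i` all have the sign of `d`.
  obtain ⟨e, he⟩ : ∃ e : ℤ, ∀ i : Fin n, (a i.castSucc : ℤ) = e * u i := by
    refine ⟨d.sign, fun i => ?_⟩
    have h : (a i.castSucc : ℝ) = (d.sign : ℝ) * u i := by
      have h3 : (d.sign : ℝ) * d = |(d : ℝ)| := by exact_mod_cast Int.sign_mul_self_eq_abs d
      rw [hcast, ← hβB, ← h3]
      ring
    exact_mod_cast h
  refine ⟨a, hgcd, hlast, hcast, shiftedFrobeniusNumber_le_of_covering hgcd fun y => ?_⟩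
  obtain ⟨w, hle, hsum⟩ := hcov fun i => β i * y i
  refine ⟨w ᵥ* B, ?_, fun i => le_of_mul_le_mul_left (hle i) (hβ i), ?_⟩
  · have h : ∑ i, (a i.castSucc : ℤ) * (w ᵥ* B) i = e * (d * (w ⬝ᵥ c)) := by
      calc ∑ i, (a i.castSucc : ℤ) * (w ᵥ* B) i = e * ((w ᵥ* B) ⬝ᵥ u) := by
            rw [dotProduct, Finset.mul_sum]
            exact Finset.sum_congr rfl fun i _ => by rw [he]; ring
        _ = e * (d * (w ⬝ᵥ c)) := by
            rw [← Matrix.dotProduct_mulVec, hu, Matrix.mulVec_cramer, dotProduct_smul, smul_eq_mul]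
    rw [h, halast, Int.natCast_natAbs, abs_dvd]
    exact (dvd_mul_right _ _).mul_left _
  · have h : ∑ i, (a i.castSucc : ℝ) * (y i - (w ᵥ* B) i) =
        |(d : ℝ)| * ∑ i, (β i * y i - β i * ((w ᵥ* B) i : ℝ)) := by
      rw [Finset.mul_sum]
      exact Finset.sum_congr rfl fun i _ => by rw [hcast]; ring
    rw [h]
    exact mul_le_mul_of_nonneg_left hsum hdR.le

/-- The lower bound for `f(a)` is almost attained by some `a` whose ratios are near a given strictly
increasing sequence in `(0, 1)`. -/
theorem exists_shiftedFrobeniusNumber_lt_of_strictMono {k : ℕ} {α : Fin (k + 1) → ℝ}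
    (hα0 : ∀ i, 0 < α i) (hα : StrictMono α) (hα1 : ∀ i, α i < 1) {ε : ℝ} (hε : 0 < ε) :
    ∃ a : Fin (k + 2) → ℕ, (∀ i, 0 < a i) ∧ StrictMono a ∧ Finset.univ.gcd a = 1 ∧
      (∀ i : Fin (k + 1), |α i - (a i.castSucc : ℝ) / (a (Fin.last (k + 1)) : ℝ)| < ε) ∧
      (shiftedFrobeniusNumber a : ℝ) / (∏ i, (a i : ℝ)) ^ (1 / ((k + 1 : ℕ) : ℝ)) <
        absoluteInhomogeneousMinimum (standardSimplex (k + 1)) + ε := by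
  obtain ⟨σ, hσ, hσlt, B₀, hB₀, hcov⟩ :=
    exists_covering_matrix_lt_absoluteInhomogeneousMinimum_add (n := k + 1) hε
  set μ := absoluteInhomogeneousMinimum (standardSimplex (k + 1)) with hμ
  have hB₀0 : B₀.det ≠ 0 := fun h => by simp [h] at hB₀
  have hGdet : ∀ᶠ g : Matrix (Fin (k + 1)) (Fin (k + 1)) ℝ in 𝓝 1, g.det ≠ 0 :=
    (continuous_id.matrix_det.continuousAt (x := (1 : Matrix (Fin (k + 1)) (Fin (k + 1)) ℝ)
      )).eventually_ne (by simp)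
  have hGlt : ∀ᶠ g : Matrix (Fin (k + 1)) (Fin (k + 1)) ℝ in 𝓝 1,
      σ * (1 + ((k + 1 : ℕ) + 1) * ∑ i, ∑ j, |(g - 1) i j|) <
        (μ + ε) * |g.det| ^ (1 / ((k + 1 : ℕ) : ℝ)) := by
    have hl : Continuous fun g : Matrix (Fin (k + 1)) (Fin (k + 1)) ℝ =>
        σ * (1 + (((k + 1 : ℕ) : ℝ) + 1) * ∑ i, ∑ j, |(g - 1) i j|) := by
      simp only [Matrix.sub_apply]
      fun_prop
    have hr : ContinuousAt (fun g : Matrix (Fin (k + 1)) (Fin (k + 1)) ℝ =>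
        (μ + ε) * |g.det| ^ (1 / ((k + 1 : ℕ) : ℝ))) 1 := by
      refine continuousAt_const.mul (ContinuousAt.rpow_const ?_ (Or.inl (by simp)))
      exact continuous_id.matrix_det.abs.continuousAt
    refine hl.continuousAt.eventually_lt hr ?_
    simpa using hσlt
  have hβev : ∀ᶠ β in 𝓝 α, (∀ i, |α i - β i| < ε) ∧ (∀ i, 0 < β i) ∧
      (∀ i, β i < 1) ∧ (∀ i j, i < j → β i < β j) := by
    have hβ : ∀ i, Tendsto (fun β : Fin (k + 1) → ℝ => β i) (𝓝 α) (𝓝 (α i)) :=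
      fun i => (continuous_apply i).tendsto α
    refine .and (eventually_all.mpr fun i => ?_) (.and (eventually_all.mpr fun i => ?_)
      (.and (eventually_all.mpr fun i => ?_)
        (eventually_all.mpr fun i => eventually_all.mpr fun j => ?_)))
    · have h := ((hβ i).const_sub (α i)).abs
      rw [sub_self, abs_zero] at h
      exact h.eventually_lt_const hε
    · exact (hβ i).eventually_const_lt (hα0 i)
    · exact (hβ i).eventually_lt_const (hα1 i)
    · by_cases hij : i < j
      · filter_upwards [(hβ i).eventually_lt (hβ j) (hα hij)] with q hq _ using hq
      · exact .of_forall fun _ h => absurd h hij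
  obtain ⟨s, hs, B, c, β, G, hB, hBc, hβB, hmat, ⟨h1, h2, h3, h4⟩, h5, h6⟩ :=
    exists_hasCoprimeMinors_near hB₀0 (fun i => (hα0 i).ne') hβev (hGdet.and hGlt)
  have hBR : (B.det : ℝ) ≠ 0 := by exact_mod_cast hB
  have hdetB : (B.map (Int.cast : ℤ → ℝ)).det = B.det := (Int.cast_det B).symm
  have hrow : ∀ (w : Fin (k + 1) → ℤ) i, ((fun j => (w j : ℝ)) ᵥ* (B₀ * G)) i =
      s * (β i * ((w ᵥ* B) i : ℝ)) := by
    intro w i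
    rw [hmat, Matrix.vecMul_smul, ← Matrix.vecMul_vecMul, Pi.smul_apply, Matrix.vecMul_diagonal]
    simp [Matrix.vecMul, dotProduct, mul_comm]
  have hdetG : |G.det| = s ^ (k + 1) * (|(B.det : ℝ)| * ∏ i, β i) := by
    have h := congrArg (fun M => |Matrix.det M|) hmat
    simp only [Matrix.det_mul, Matrix.det_smul, abs_mul, hB₀, one_mul, hdetB, Matrix.det_diagonal,
      Fintype.card_fin] at h
    rw [h, abs_of_pos (pow_pos hs _), abs_of_pos (Finset.prod_pos fun i _ => h2 i)]
  set κ : ℝ := σ * (1 + ((k + 1 : ℕ) + 1) * ∑ i, ∑ j, |(G - 1) i j|) with hκ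
  obtain ⟨a, hgcd, hlast, hcast, hf⟩ :=
    exists_shiftedFrobeniusNumber_le_of_hasCoprimeMinors hB hBc h2 hβB
    (ρ := s⁻¹ * κ) fun y => by
      obtain ⟨w, hle, hsum⟩ := exists_covering_mul hcov h5 (s • y)
      simp only [hrow, Pi.smul_apply, smul_eq_mul] at hle hsum
      refine ⟨w, fun i => le_of_mul_le_mul_left (hle i) hs, ?_⟩
      rw [le_inv_mul_iff₀ hs, Finset.mul_sum]
      simpa only [mul_sub] using hsum
  have hm : 0 < |(B.det : ℝ)| := abs_pos.mpr hBR
  set m : ℝ := |(B.det : ℝ)| with hmdef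
  have hpos : ∀ i, (0 : ℝ) < a i := fun i => by
    induction i using Fin.lastCases with
    | last => rw [hlast]; exact hm
    | cast i => rw [hcast]; exact mul_pos (h2 i) hm
  refine ⟨a, fun i => by exact_mod_cast hpos i, ?_, hgcd, fun i => ?_, ?_⟩
  · intro i j hij
    have : (a i : ℝ) < a j := by
      induction i using Fin.lastCases with
      | last => exact absurd hij (Fin.le_last j).not_gt
      | cast i =>
        induction j using Fin.lastCases with
        | last =>
          rw [hlast, hcast]
          exact mul_lt_of_lt_one_left hm (h3 i)
        | cast j =>
          rw [hcast, hcast]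
          exact mul_lt_mul_of_pos_right (h4 i j (Fin.castSucc_lt_castSucc_iff.mp hij)) hm
    exact_mod_cast this
  · rw [hlast, hcast, mul_div_cancel_right₀ _ hm.ne']
    exact h1 i
  · have hprod : ∏ i, (a i : ℝ) = (m / s) ^ (k + 1) * |G.det| := by
      rw [Fin.prod_univ_castSucc, hlast, hdetG]
      simp only [hcast, Finset.prod_mul_distrib, Finset.prod_const, Finset.card_univ,
        Fintype.card_fin, div_pow]
      field_simp
    have ht : (∏ i, (a i : ℝ)) ^ (1 / ((k + 1 : ℕ) : ℝ)) =
        m / s * |G.det| ^ (1 / ((k + 1 : ℕ) : ℝ)) := by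
      rw [hprod, Real.mul_rpow (by positivity) (abs_nonneg _), one_div,
        Real.pow_rpow_inv_natCast (by positivity) (by omega)]
    rw [div_lt_iff₀ (Real.rpow_pos_of_pos (Finset.prod_pos fun i _ => hpos i) _), ht]
    calc (shiftedFrobeniusNumber a : ℝ) ≤ m * (s⁻¹ * κ) := hf
      _ = m / s * κ := by ring
      _ < m / s * ((μ + ε) * |G.det| ^ (1 / ((k + 1 : ℕ) : ℝ))) :=
        mul_lt_mul_of_pos_left h6 (div_pos hm hs)
      _ = _ := by ring

/-- Any monotone sequence in `[0, 1]` is approximated by strictly increasing ones in `(0, 1)`. -/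
theorem exists_strictMono_near {n : ℕ} {α : Fin n → ℝ} (hα0 : ∀ i, 0 ≤ α i) (hα : Monotone α)
    (hα1 : ∀ i, α i ≤ 1) {ε : ℝ} (hε : 0 < ε) :
    ∃ α' : Fin n → ℝ, (∀ i, 0 < α' i) ∧ StrictMono α' ∧ (∀ i, α' i < 1) ∧
      ∀ i, |α i - α' i| < ε := by
  obtain ⟨η, hη0, hη1, hηε⟩ : ∃ η : ℝ, 0 < η ∧ η < 1 ∧ η < ε :=
    ⟨min (1 / 2) (ε / 2), by positivity, (min_le_left _ _).trans_lt (by norm_num),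
      (min_le_right _ _).trans_lt (by linarith)⟩
  let u : Fin n → ℝ := fun i => ((i : ℝ) + 1) / (n + 1)
  have hu0 : ∀ i, 0 < u i := fun i => by positivity
  have hu1 : ∀ i, u i < 1 := fun i => by
    have : (i : ℝ) < n := by exact_mod_cast i.2
    exact (div_lt_one (by positivity)).mpr (by linarith)
  have hu : StrictMono u := fun i j hij => by
    have : (i : ℝ) < j := by exact_mod_cast hij
    exact div_lt_div_of_pos_right (by linarith) (by positivity)
  refine ⟨fun i => (1 - η) * α i + η * u i, fun i => ?_, fun i j hij => ?_, fun i => ?_,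
    fun i => ?_⟩
  · exact add_pos_of_nonneg_of_pos (mul_nonneg (by linarith) (hα0 i)) (mul_pos hη0 (hu0 i))
  · exact add_lt_add_of_le_of_lt (mul_le_mul_of_nonneg_left (hα hij.le) (by linarith))
      (mul_lt_mul_of_pos_left (hu hij) hη0)
  · have h1 := mul_le_mul_of_nonneg_left (hα1 i) (by linarith : 0 ≤ 1 - η)
    have h2 := mul_lt_mul_of_pos_left (hu1 i) hη0
    linarith
  · have h1 : α i - ((1 - η) * α i + η * u i) = η * (α i - u i) := by ring
    have h2 : |α i - u i| ≤ 1 :=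
      abs_le.mpr ⟨by linarith [hα0 i, hu1 i], by linarith [hα1 i, hu0 i]⟩
    rw [h1, abs_mul, abs_of_pos hη0]
    exact (mul_le_of_le_one_right hη0.le h2).trans_lt hηε

/-- Here `N = n + 1`; part (i) is for `N ≥ 3` and part (ii) for `N ≥ 2`. The entries of `a` are
indexed by `0, …, n`, so that `a (Fin.last n)` is the largest one. -/
theorem theorem1 (n : ℕ) :
    (2 ≤ n → ∀ a : Fin (n + 1) → ℕ, (∀ i, 0 < a i) → StrictMono a → Finset.univ.gcd a = 1 →
      IsGreatest {m : ℤ | ¬ ∃ x : Fin (n + 1) → ℕ, (∀ i, 0 < x i) ∧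
          m = ∑ i, (a i : ℤ) * (x i : ℤ)} (shiftedFrobeniusNumber a) ∧
      absoluteInhomogeneousMinimum (standardSimplex n) ≤
        (shiftedFrobeniusNumber a : ℝ) / (∏ i, (a i : ℝ)) ^ (1 / (n : ℝ))) ∧
    (1 ≤ n → ∀ α : Fin n → ℝ, (∀ i, 0 ≤ α i) → Monotone α → (∀ i, α i ≤ 1) →
      ∀ ε : ℝ, 0 < ε →
      ∃ a : Fin (n + 1) → ℕ, (∀ i, 0 < a i) ∧ StrictMono a ∧ Finset.univ.gcd a = 1 ∧
        (∀ i : Fin n, |α i - (a i.castSucc : ℝ) / (a (Fin.last n) : ℝ)| < ε) ∧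
        (shiftedFrobeniusNumber a : ℝ) / (∏ i, (a i : ℝ)) ^ (1 / (n : ℝ)) <
          absoluteInhomogeneousMinimum (standardSimplex n) + ε) := by
  refine ⟨fun hn a ha _ hgcd => ⟨isGreatest_shiftedFrobeniusNumber hgcd,
    absoluteInhomogeneousMinimum_le_shiftedFrobeniusNumber_div (by omega) ha hgcd⟩,
    fun hn α hα0 hα hα1 ε hε => ?_⟩
  obtain ⟨k, rfl⟩ : ∃ k, n = k + 1 := ⟨n - 1, by omega⟩
  obtain ⟨α', h0, hmono, h1, hnear⟩ := exists_strictMono_near hα0 hα hα1 (half_pos hε)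
  obtain ⟨a, ha, hamono, hgcd, hratio, hf⟩ := exists_shiftedFrobeniusNumber_lt_of_strictMono
    h0 hmono h1 (half_pos hε)
  refine ⟨a, ha, hamono, hgcd, fun i => ?_, hf.trans (by linarith)⟩
  have h := abs_sub_le (α i) (α' i) ((a i.castSucc : ℝ) / (a (Fin.last (k + 1)) : ℝ))
  linarith [hnear i, hratio i]
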